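/- Let $n\in\mathbb N$, let $1<\gamma<n$ be real, put $\gamma^*=\frac{n\gamma}{n-\gamma}$, and let $p\in\mathbb R$. A positive classical solution of the $\gamma$-Laplace equation $$-\Delta_\gamma u:=-\operatorname{div}\big(|\nabla u|^{\gamma-2}\nabla u\big)=u^p\quad\text{on }\mathbb R^n$$ is a function $u:\mathbb R^n\to(0,\infty)$ such that $u$ and the vector field $|\nabla u|^{\gamma-2}\nabla u$ (understood as $0$ where $\nabla u=0$) are of class $C^1$ on $\mathbb R^n$ and the equation holds at every point. Then there is a positive classical solution $u$ with $\int_{\mathbb R^n}|\nabla u|^\gamma\,dx<\infty$ if and only if $p=\gamma^*-1$. -/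

import Mathlib

open MeasureTheory

noncomputable section

/-- The divergence `∑ i, ∂ᵢ Vᵢ` of a vector field on Euclidean space. -/
def euclideanDiv {n : ℕ} (V : EuclideanSpace ℝ (Fin n) → EuclideanSpace ℝ (Fin n))
    (x : EuclideanSpace ℝ (Fin n)) : ℝ :=
  ∑ i, (fderiv ℝ V x (EuclideanSpace.single i 1)) i

/-- The vector field `|∇u|^(γ-2) ∇u`, equal to `0` where `∇u = 0` (for every real `γ`). -/
def gammaFlux {n : ℕ} (γ : ℝ) (u : EuclideanSpace ℝ (Fin n) → ℝ)
    (x : EuclideanSpace ℝ (Fin n)) : EuclideanSpace ℝ (Fin n) :=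
  ‖gradient u x‖ ^ (γ - 2) • gradient u x

/-- The `γ`-Laplacian `Δ_γ u = div (|∇u|^(γ-2) ∇u)`. -/
def gammaLaplacian {n : ℕ} (γ : ℝ) (u : EuclideanSpace ℝ (Fin n) → ℝ)
    (x : EuclideanSpace ℝ (Fin n)) : ℝ :=
  euclideanDiv (gammaFlux γ u) x

/-- `u` is a positive classical solution of `-Δ_γ u = u ^ p` on the whole space: every derivative
which occurs in the equation exists and is continuous (that is, `u` and `|∇u|^(γ-2) ∇u` are both
of class `C¹`), and the equation holds at every point. For `γ = 2` this is the usual notion, with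
`u` of class `C²`. -/
structure IsPositiveClassicalSolution {n : ℕ} (γ p : ℝ)
    (u : EuclideanSpace ℝ (Fin n) → ℝ) : Prop where
  pos : ∀ x, 0 < u x
  contDiff : ContDiff ℝ 1 u
  contDiff_flux : ContDiff ℝ 1 (gammaFlux γ u)
  equation : ∀ x, -gammaLaplacian γ u x = u x ^ p

end

/-! Write V = |∇u|^(γ-2) ∇u and I = ∫ |∇u|^γ. For necessity, two identities are compared: the energy
identity ∫ u^(p+1) = I, and the Pohozaev identity (γ - n) I = γ ∫ u^p x·∇u, whose right side is -γ
n/(p+1) ∫ u^(p+1). As I > 0, they force p + 1 = nγ/(n - γ). Both are first proved with a cutoff ζ at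
scale R (`integral_mul_rpow_add_one`, `pohozaev`), and two points need care.

Regularity: u is only C¹, so the equation cannot be multiplied by x·∇u and integrated by parts
directly. Instead, u minimizes the convex functional v ↦ ∫ ζ|∇v|^γ - γ ∫ w v with w = -div(ζV).
Along the dilates u(l·) the derivative at l = 1 therefore vanishes, and a change of variables lets
that derivative fall on ζ.

Decay: no behaviour at infinity is assumed. Since γ < n, Hölder along rays shows that ∇u is
integrable along almost every ray, so u has a radial limit. Testing the equation with ζ shows that
the average of u^p over a ball of radius R is O(1/R). This excludes p ≤ 0 and makes the radial limit
0 (`exponent_pos_and_ae_tendsto`). Hardy's inequality then puts |u|/|x| in L^γ; with |x||∇ζ|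
bounded, every boundary term tends to 0 by dominated convergence (`exponent_eq`).

For sufficiency, the Aubin–Talenti function c (1 + |x|^(γ/(γ-1)))^(-(n-γ)/γ) is an explicit solution
for a suitable c. -/

open Filter Topology Set

/-! ### Differentiating integrals along dilations -/

section Dilation

variable {E : Type*} [NormedAddCommGroup E] [NormedSpace ℝ E] [FiniteDimensional ℝ E]
  [MeasurableSpace E] [BorelSpace E] (μ : Measure E) [μ.IsAddHaarMeasure]

/-- Differentiation of a weighted integral along dilations, when only a bounded region matters. -/
theorem hasDerivAt_integral_mul_comp_smul {w F : E → ℝ} (hw : Continuous w)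
    (hF : ContDiff ℝ 1 F) (R : ℝ)
    (hR : ∀ x, R < ‖x‖ → w x = 0 ∨ ∀ l ∈ Metric.ball (1 : ℝ) (1 / 2), F (l • x) = 0) :
    HasDerivAt (fun l : ℝ => ∫ x, w x * F (l • x) ∂μ) (∫ x, w x * fderiv ℝ F x x ∂μ) 1 := by
  have hcF := hF.continuous
  have hcF' : Continuous (fderiv ℝ F) := hF.continuous_fderiv (by norm_num)
  have hcomp : ∀ f : E → ℝ, (∀ x, R < ‖x‖ → f x = 0) → HasCompactSupport f := fun f hf =>
    HasCompactSupport.intro (isCompact_closedBall (0 : E) R) fun x hx => hf x (by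
      simpa using hx)
  have hdiff : ∀ x l, HasDerivAt (fun l : ℝ => w x * F (l • x))
      (w x * fderiv ℝ F (l • x) x) l := by
    intro x l
    have h1 : HasDerivAt (fun l : ℝ => l • x) x l := by
      simpa using (hasDerivAt_id l).smul_const x
    have h2 := ((hF.differentiable (by norm_num)) (l • x)).hasFDerivAt.comp_hasDerivAt l h1
    exact h2.const_mul (w x)
  have hzero : ∀ x, R < ‖x‖ → ∀ l ∈ Metric.ball (1 : ℝ) (1 / 2),
      w x * fderiv ℝ F (l • x) x = 0 := by
    intro x hx l hl
    rcases hR x hx with h | h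
    · simp [h]
    -- Here `F (m • x)` vanishes for all `m` near `l`, so its derivative in the dilation factor
    -- vanishes too.
    · refine (hdiff x l).unique ((hasDerivAt_const l (0 : ℝ)).congr_of_eventuallyEq ?_)
      filter_upwards [Metric.isOpen_ball.mem_nhds hl] with m hm
      simp [h m hm]
  obtain ⟨M, hM⟩ : ∃ M, ∀ z ∈ Metric.closedBall (1 : ℝ) (1 / 2) ×ˢ Metric.closedBall (0 : E) R,
      ‖w z.2 * fderiv ℝ F (z.1 • z.2) z.2‖ ≤ M := by
    apply ((isCompact_closedBall _ _).prod (isCompact_closedBall _ _)).exists_bound_of_continuousOn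
    apply Continuous.continuousOn
    fun_prop
  have h := hasDerivAt_integral_of_dominated_loc_of_deriv_le (μ := μ) (x₀ := (1 : ℝ))
    (F := fun l x => w x * F (l • x)) (F' := fun l x => w x * fderiv ℝ F (l • x) x)
    (bound := (Metric.closedBall (0 : E) R).indicator fun _ => M)
    (Metric.ball_mem_nhds 1 (by norm_num : (0 : ℝ) < 1 / 2)) ?_ ?_ ?_ ?_ ?_ ?_
  · simpa using h.2
  · exact Eventually.of_forall fun l => by
      apply Continuous.aestronglyMeasurable; fun_prop
  · apply Continuous.integrable_of_hasCompactSupport (by fun_prop)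
    apply hcomp
    intro x hx
    rcases hR x hx with h | h
    · simp [h]
    · exact mul_eq_zero_of_right _ (h 1 (Metric.mem_ball_self (by norm_num)))
  · apply Continuous.aestronglyMeasurable; fun_prop
  · refine Eventually.of_forall fun x l hl => ?_
    by_cases hx : x ∈ Metric.closedBall (0 : E) R
    · rw [indicator_of_mem hx]
      exact hM (l, x) ⟨Metric.ball_subset_closedBall hl, hx⟩
    · rw [indicator_of_notMem hx, hzero x (by simpa using hx) l hl, norm_zero]
  · exact (integrable_indicator_iff measurableSet_closedBall).2
      (integrableOn_const (by exact measure_closedBall_lt_top.ne))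
  · exact Eventually.of_forall fun x l _ => hdiff x l

theorem integral_mul_comp_smul (ζ h : E → ℝ) {l : ℝ} (hl : 0 < l) :
    ∫ x, ζ x * h (l • x) ∂μ
      = (l ^ Module.finrank ℝ E)⁻¹ * ∫ x, h x * ζ (l⁻¹ • x) ∂μ := by
  have := Measure.integral_comp_smul_of_nonneg μ (fun y => h y * ζ (l⁻¹ • y)) l (hR := hl.le)
  simp only [smul_eq_mul, inv_smul_smul₀ hl.ne'] at this
  rw [← this]
  simp_rw [mul_comm]

/-- The change of variables y = l x moves the dilation from `h` to `ζ`, so `h` need only be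
continuous. This matters for h = |∇u|^γ, which need not be differentiable. -/
theorem hasDerivAt_integral_comp_smul_of_hasCompactSupport {ζ h : E → ℝ} (hζ : ContDiff ℝ 1 ζ)
    (hζc : HasCompactSupport ζ) (hh : Continuous h) :
    HasDerivAt (fun l : ℝ => ∫ x, ζ x * h (l • x) ∂μ)
      (-((Module.finrank ℝ E : ℝ) * ∫ x, ζ x * h x ∂μ) - ∫ x, fderiv ℝ ζ x x * h x ∂μ) 1 := by
  obtain ⟨R, hRpos, hR⟩ := hζc.isCompact.isBounded.exists_pos_norm_le
  -- The radius doubles because l > 1/2: then ‖x‖ > 2R gives ‖l x‖ > R, outside the support of `ζ`.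
  have h1 := hasDerivAt_integral_mul_comp_smul μ hh hζ (2 * R) (fun x hx => Or.inr (by
    intro l hl
    by_contra hne
    have := hR _ (subset_tsupport _ hne)
    rw [Metric.mem_ball, Real.dist_eq, abs_lt] at hl
    rw [norm_smul, Real.norm_of_nonneg (by linarith)] at this
    nlinarith [norm_nonneg x]))
  have h2 : HasDerivAt (fun l : ℝ => l⁻¹) (-1) 1 := by
    simpa using hasDerivAt_inv (one_ne_zero : (1 : ℝ) ≠ 0)
  have h1' : HasDerivAt (fun l : ℝ => ∫ x, h x * ζ (l • x) ∂μ)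
      (∫ x, h x * fderiv ℝ ζ x x ∂μ) ((1 : ℝ)⁻¹) := by simpa using h1
  have h3 := h1'.comp (1 : ℝ) h2
  have h4 : HasDerivAt (fun l : ℝ => (l ^ Module.finrank ℝ E)⁻¹)
      (-(Module.finrank ℝ E : ℝ)) 1 := by
    have := (hasDerivAt_pow (Module.finrank ℝ E) (1 : ℝ)).inv (by simp)
    simp only [one_pow, mul_one, div_one] at this
    exact this
  have h5 := h4.mul h3
  have h6 : HasDerivAt (fun l : ℝ => ∫ x, ζ x * h (l • x) ∂μ) _ 1 :=
    h5.congr_of_eventuallyEq (by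
      filter_upwards [lt_mem_nhds (zero_lt_one : (0 : ℝ) < 1)] with l hl
      rw [integral_mul_comp_smul μ ζ h hl]
      rfl)
  convert! h6 using 1
  simp only [Function.comp, inv_one, one_smul, one_pow]
  simp_rw [mul_comm (h _)]
  ring

end Dilation

/-! ### The flux, the weak equation and the identities with a cutoff -/

section Solution

variable {n : ℕ} {γ p : ℝ} {u : EuclideanSpace ℝ (Fin n) → ℝ}

theorem norm_gradient_eq (x : EuclideanSpace ℝ (Fin n)) : ‖gradient u x‖ = ‖fderiv ℝ u x‖ :=
  LinearIsometryEquiv.norm_map _ _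

theorem ContDiff.continuous_gradient (hu : ContDiff ℝ 1 u) : Continuous (gradient u) :=
  (LinearIsometryEquiv.continuous _).comp (hu.continuous_fderiv (by norm_num))

theorem norm_gammaFlux (hγ : 1 < γ) (x : EuclideanSpace ℝ (Fin n)) :
    ‖gammaFlux γ u x‖ = ‖gradient u x‖ ^ (γ - 1) := by
  rw [gammaFlux, norm_smul, Real.norm_of_nonneg (by positivity)]
  rcases (norm_nonneg (gradient u x)).eq_or_lt with h | h
  · rw [← h, mul_zero, Real.zero_rpow (by linarith)]
  · rw [← Real.rpow_add_one h.ne']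
    ring_nf

theorem fderiv_apply_gammaFlux (hγ : 1 < γ) (x : EuclideanSpace ℝ (Fin n)) :
    fderiv ℝ u x (gammaFlux γ u x) = ‖gradient u x‖ ^ γ := by
  have h1 : fderiv ℝ u x (gradient u x) = ‖gradient u x‖ ^ 2 := by
    rw [← real_inner_self_eq_norm_sq]
    exact (InnerProductSpace.toDual_symm_apply).symm
  rw [gammaFlux, map_smul, h1, smul_eq_mul]
  rcases (norm_nonneg (gradient u x)).eq_or_lt with h | h
  · rw [← h, Real.zero_rpow (x := γ) (by linarith)]
    simp
  · rw [← Real.rpow_natCast, ← Real.rpow_add h]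
    norm_num

theorem abs_apply_gammaFlux_le (hγ : 1 < γ) (L : EuclideanSpace ℝ (Fin n) →L[ℝ] ℝ)
    (x : EuclideanSpace ℝ (Fin n)) :
    |L (gammaFlux γ u x)| ≤ ‖L‖ * ‖gradient u x‖ ^ (γ - 1) := by
  rw [← norm_gammaFlux hγ, ← Real.norm_eq_abs]
  exact L.le_opNorm _

/-- Convexity of `|·| ^ γ / γ`, whose gradient at `∇u` is the flux. -/
theorem apply_gammaFlux_sub_le (hγ : 1 < γ) (L : EuclideanSpace ℝ (Fin n) →L[ℝ] ℝ)
    (x : EuclideanSpace ℝ (Fin n)) :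
    (L - fderiv ℝ u x) (gammaFlux γ u x) ≤ (‖L‖ ^ γ - ‖gradient u x‖ ^ γ) / γ := by
  have hq : γ.HolderConjugate (Real.conjExponent γ) := Real.HolderConjugate.conjExponent hγ
  have h1 := Real.young_inequality_of_nonneg (norm_nonneg L)
    (Real.rpow_nonneg (norm_nonneg (gradient u x)) (γ - 1)) hq
  rw [← Real.rpow_mul (norm_nonneg _), hq.sub_one_mul_conj] at h1
  have h2 := (le_abs_self _).trans (abs_apply_gammaFlux_le (u := u) hγ L x)
  have h3 : ‖gradient u x‖ ^ γ / γ.conjExponent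
      = ‖gradient u x‖ ^ γ - ‖gradient u x‖ ^ γ / γ := by
    rw [div_eq_mul_inv, div_eq_mul_inv, eq_sub_of_add_eq' hq.inv_add_inv_eq_one]
    ring
  rw [sub_apply, fderiv_apply_gammaFlux hγ, sub_div]
  linarith

theorem integral_mul_euclideanDiv {V : EuclideanSpace ℝ (Fin n) → EuclideanSpace ℝ (Fin n)}
    (hV : ContDiff ℝ 1 V) {φ : EuclideanSpace ℝ (Fin n) → ℝ} (hφ : ContDiff ℝ 1 φ)
    (hφc : HasCompactSupport φ) :
    ∫ x, φ x * euclideanDiv V x = -∫ x, fderiv ℝ φ x (V x) := by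
  have hVi : ∀ i, ContDiff ℝ 1 fun x => V x i := fun i => by fun_prop
  have hcV := hV.continuous
  have hcV' : Continuous (fderiv ℝ V) := hV.continuous_fderiv (by norm_num)
  have hcφ := hφ.continuous
  have hcφ' : Continuous (fderiv ℝ φ) := hφ.continuous_fderiv (by norm_num)
  have hφc' : HasCompactSupport (fderiv ℝ φ) := hφc.fderiv ℝ
  have hfd : ∀ i x v, fderiv ℝ (fun x => V x i) x v = (fderiv ℝ V x v) i := by
    intro i x v
    have h1 := (((hV.differentiable (by norm_num)) x).hasFDerivAt)
    have h2 := (EuclideanSpace.proj (𝕜 := ℝ) i).hasFDerivAt.comp x h1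
    have h3 : HasFDerivAt (fun x => V x i) _ x := h2
    rw [h3.fderiv]
    rfl
  have hint1 : ∀ i, Integrable fun x => φ x * fderiv ℝ (fun x => V x i) x
      (EuclideanSpace.single i 1) := by
    intro i
    simp_rw [hfd]
    exact Continuous.integrable_of_hasCompactSupport (by fun_prop) hφc.mul_right
  have hint2 : ∀ i, Integrable fun x => fderiv ℝ φ x (EuclideanSpace.single i 1) * V x i := by
    intro i
    refine Continuous.integrable_of_hasCompactSupport (by fun_prop) ?_
    exact hφc'.mono fun x hx h0 => hx (by simp [h0])
  have hibp : ∀ i, ∫ x, φ x * fderiv ℝ (fun x => V x i) x (EuclideanSpace.single i 1)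
      = -∫ x, fderiv ℝ φ x (EuclideanSpace.single i 1) * V x i := by
    intro i
    refine integral_mul_fderiv_eq_neg_fderiv_mul_of_integrable (hint2 i) (hint1 i) ?_
      (fun x _ => hφ.differentiable (by norm_num) x)
      (fun x _ => (hVi i).differentiable (by norm_num) x)
    exact Continuous.integrable_of_hasCompactSupport (by fun_prop) hφc.mul_right
  have hsum : ∀ x, fderiv ℝ φ x (V x)
      = ∑ i, fderiv ℝ φ x (EuclideanSpace.single i 1) * V x i := by
    intro x
    have : V x = ∑ i, V x i • EuclideanSpace.single i (1 : ℝ) := by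
      ext j
      simp [Finset.sum_apply, Pi.single_apply]
    conv_lhs => rw [this]
    simp only [map_sum, map_smul, smul_eq_mul]
    exact Finset.sum_congr rfl fun i _ => mul_comm _ _
  simp_rw [hsum, euclideanDiv, Finset.mul_sum]
  rw [integral_finsetSum _ fun i _ => hint2 i, ← Finset.sum_neg_distrib,
    integral_finsetSum _ fun i _ => by simpa only [hfd] using hint1 i]
  refine Finset.sum_congr rfl fun i _ => ?_
  rw [← hibp i]
  simp_rw [hfd]

namespace IsPositiveClassicalSolution

/-- The weak form is the only way in which the equation enters the necessity half. -/
theorem integral_mul_rpow_eq (hu : IsPositiveClassicalSolution γ p u)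
    {φ : EuclideanSpace ℝ (Fin n) → ℝ} (hφ : ContDiff ℝ 1 φ) (hφc : HasCompactSupport φ) :
    ∫ x, φ x * u x ^ p = ∫ x, fderiv ℝ φ x (gammaFlux γ u x) := by
  have h := integral_mul_euclideanDiv hu.contDiff_flux hφ hφc
  rw [← neg_inj, ← h, ← integral_neg]
  refine integral_congr_ae (Eventually.of_forall fun x => ?_)
  simp only [← hu.equation x, gammaLaplacian]
  ring

theorem contDiff_rpow (hu : IsPositiveClassicalSolution γ p u) (s : ℝ) :
    ContDiff ℝ 1 fun x => u x ^ s :=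
  hu.contDiff.rpow_const_of_ne fun x => (hu.pos x).ne'

/-- The energy identity with a cutoff. -/
theorem integral_mul_rpow_add_one (hγ : 1 < γ) (hu : IsPositiveClassicalSolution γ p u)
    {ζ : EuclideanSpace ℝ (Fin n) → ℝ} (hζ : ContDiff ℝ 1 ζ) (hζc : HasCompactSupport ζ) :
    ∫ x, ζ x * u x ^ (p + 1)
      = (∫ x, ζ x * ‖gradient u x‖ ^ γ) + ∫ x, u x * fderiv ℝ ζ x (gammaFlux γ u x) := by
  have hcu := hu.contDiff.continuous
  have hcg := hu.contDiff.continuous_gradient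
  have hcζ := hζ.continuous
  have hcζ' : Continuous (fderiv ℝ ζ) := hζ.continuous_fderiv (by norm_num)
  have hcV := hu.contDiff_flux.continuous
  have h := hu.integral_mul_rpow_eq (hζ.mul hu.contDiff) hζc.mul_right
  have e1 : ∀ x, ζ x * u x ^ (p + 1) = ζ x * u x * u x ^ p := fun x => by
    rw [Real.rpow_add_one (hu.pos x).ne']; ring
  have e2 : ∀ x, fderiv ℝ (fun x => ζ x * u x) x (gammaFlux γ u x)
      = ζ x * ‖gradient u x‖ ^ γ + u x * fderiv ℝ ζ x (gammaFlux γ u x) := fun x => by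
    rw [fderiv_fun_mul (hζ.differentiable (by norm_num) x)
      (hu.contDiff.differentiable (by norm_num) x)]
    simp [fderiv_apply_gammaFlux hγ]
  simp_rw [e1, h, e2]
  refine integral_add ?_ ?_
  · refine Continuous.integrable_of_hasCompactSupport ?_ hζc.mul_right
    exact hcζ.mul (hcg.norm.rpow_const fun x => Or.inr (by linarith))
  · refine Continuous.integrable_of_hasCompactSupport (by fun_prop) ?_
    have hζc' : HasCompactSupport (fderiv ℝ ζ) := hζc.fderiv ℝ
    exact hζc'.mono fun x hx h0 => hx (by simp [h0])

/-- Both sides are the derivative at l = 1 of ∫ ζ(x) u(l x)^(p+1) dx, computed under the integral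
and after a change of variables. -/
theorem integral_mul_rpow_mul_fderiv (hu : IsPositiveClassicalSolution γ p u)
    {ζ : EuclideanSpace ℝ (Fin n) → ℝ} (hζ : ContDiff ℝ 1 ζ) (hζc : HasCompactSupport ζ) :
    (p + 1) * ∫ x, ζ x * u x ^ p * fderiv ℝ u x x
      = -(n * ∫ x, ζ x * u x ^ (p + 1)) - ∫ x, fderiv ℝ ζ x x * u x ^ (p + 1) := by
  obtain ⟨R, hR⟩ := hζc.isCompact.isBounded.exists_norm_le
  have h1 := hasDerivAt_integral_mul_comp_smul volume hζ.continuous (hu.contDiff_rpow (p + 1)) R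
    (fun x hx => Or.inl (by
      by_contra hne
      exact absurd (hR x (subset_tsupport _ hne)) (not_le.2 hx)))
  have h2 := hasDerivAt_integral_comp_smul_of_hasCompactSupport volume hζ hζc
    (hu.contDiff_rpow (p + 1)).continuous
  have h3 := h1.unique h2
  rw [finrank_euclideanSpace_fin] at h3
  rw [← h3, ← integral_const_mul]
  refine integral_congr_ae (Eventually.of_forall fun x => ?_)
  have h4 := ((hu.contDiff.differentiable (by norm_num) x).hasFDerivAt).rpow_const
    (p := p + 1) (Or.inl (hu.pos x).ne')
  simp only [h4.fderiv]
  simp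
  ring

/-- The Pohozaev identity with a cutoff. It says that the derivative at `l = 1` vanishes for a
function of the dilation factor `l` which has a minimum there by convexity; no second derivatives
of `u` are used. -/
theorem pohozaev (hγ : 1 < γ) (hu : IsPositiveClassicalSolution γ p u)
    {ζ : EuclideanSpace ℝ (Fin n) → ℝ} (hζ : ContDiff ℝ 1 ζ) (hζc : HasCompactSupport ζ)
    (hζ0 : ∀ x, 0 ≤ ζ x) :
    ((γ - n) * ∫ x, ζ x * ‖gradient u x‖ ^ γ) - ∫ x, fderiv ℝ ζ x x * ‖gradient u x‖ ^ γ
      = γ * ((∫ x, ζ x * u x ^ p * fderiv ℝ u x x)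
        - ∫ x, fderiv ℝ u x x * fderiv ℝ ζ x (gammaFlux γ u x)) := by
  obtain ⟨R, hR⟩ := hζc.isCompact.isBounded.exists_norm_le
  have hζR : ∀ x, R < ‖x‖ → ζ x = 0 := fun x hx => by
    by_contra hne
    exact absurd (hR x (subset_tsupport _ hne)) (not_le.2 hx)
  have hζR' : ∀ x, R < ‖x‖ → fderiv ℝ ζ x = 0 := fun x hx => by
    by_contra hne
    exact absurd (hR x (support_fderiv_subset ℝ hne)) (not_le.2 hx)
  have hdu := hu.contDiff.differentiable (by norm_num)
  have hdζ := hζ.differentiable (by norm_num)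
  have hcu := hu.contDiff.continuous
  have hcu' : Continuous (fderiv ℝ u) := hu.contDiff.continuous_fderiv (by norm_num)
  have hcg := hu.contDiff.continuous_gradient
  have hcgγ : Continuous fun x => ‖gradient u x‖ ^ γ :=
    hcg.norm.rpow_const fun x => Or.inr (by linarith)
  have hcup := (hu.contDiff_rpow p).continuous
  have hcζ := hζ.continuous
  have hcζ' : Continuous (fderiv ℝ ζ) := hζ.continuous_fderiv (by norm_num)
  have hcV := hu.contDiff_flux.continuous
  have hcs : ∀ f : EuclideanSpace ℝ (Fin n) → ℝ, (∀ x, R < ‖x‖ → f x = 0) →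
      HasCompactSupport f := fun f hf =>
    HasCompactSupport.intro (isCompact_closedBall (0 : EuclideanSpace ℝ (Fin n)) R)
      fun x hx => hf x (by simpa using hx)
  -- This is w = -div(ζV), so u is a critical point of the convex functional v ↦ ∫ ζ|∇v|^γ - γ ∫ w
  -- v. `G l - γ * H l` is its value at v = u(l·) for l > 0.
  set w : EuclideanSpace ℝ (Fin n) → ℝ :=
    fun x => ζ x * u x ^ p - fderiv ℝ ζ x (gammaFlux γ u x) with hw
  have hcw : Continuous w := by fun_prop
  have hwR : ∀ x, R < ‖x‖ → w x = 0 := fun x hx => by simp [hw, hζR x hx, hζR' x hx]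
  set G : ℝ → ℝ := fun l =>
    l ^ γ * ∫ x, ζ x * ‖gradient u (l • x)‖ ^ γ with hG
  set H : ℝ → ℝ := fun l => ∫ x, w x * u (l • x) with hH
  -- Testing the weak equation with ζ (u(l·) - u) turns `H l - H 1` into ∫ ζ (∇(u(l·)) - ∇u)·V,
  -- which convexity bounds by `(G l - G 1) / γ`.
  have hmin : ∀ l : ℝ, 0 < l → G 1 - γ * H 1 ≤ G l - γ * H l := by
    intro l hl
    have hul : ContDiff ℝ 1 fun x => u (l • x) := by
      have := hu.contDiff; fun_prop
    have hful : ∀ x, fderiv ℝ (fun x => u (l • x)) x = l • fderiv ℝ u (l • x) := fun x =>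
      fderiv_comp_smul _
    have hweak := hu.integral_mul_rpow_eq (hζ.mul (hul.sub hu.contDiff)) hζc.mul_right
    have hd : ∀ x, fderiv ℝ (fun x => ζ x * (u (l • x) - u x)) x (gammaFlux γ u x)
        = (u (l • x) - u x) * fderiv ℝ ζ x (gammaFlux γ u x)
          + ζ x * (l • fderiv ℝ u (l • x) - fderiv ℝ u x) (gammaFlux γ u x) := fun x => by
      have hdul : DifferentiableAt ℝ (fun x => u (l • x) - u x) x :=
        (hul.differentiable (by norm_num) x).sub (hdu x)
      rw [fderiv_fun_mul (hdζ x) hdul,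
        fderiv_fun_sub (hul.differentiable (by norm_num) x) (hdu x), hful]
      simp
      ring
    have hI1 : Integrable fun x => (u (l • x) - u x) * fderiv ℝ ζ x (gammaFlux γ u x) :=
      Continuous.integrable_of_hasCompactSupport (by fun_prop)
        (hcs _ fun x hx => by simp [hζR' x hx])
    have hI2 : Integrable fun x => ζ x * (u (l • x) - u x) * u x ^ p :=
      Continuous.integrable_of_hasCompactSupport (by fun_prop)
        (hcs _ fun x hx => by simp [hζR x hx])
    have hI3 : Integrable fun x =>
        ζ x * (l • fderiv ℝ u (l • x) - fderiv ℝ u x) (gammaFlux γ u x) :=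
      Continuous.integrable_of_hasCompactSupport (by fun_prop)
        (hcs _ fun x hx => by simp [hζR x hx])
    have hI4 : ∀ m : ℝ, Integrable fun x => ζ x * ‖gradient u (m • x)‖ ^ γ := fun m =>
      Continuous.integrable_of_hasCompactSupport
        (hcζ.mul (hcgγ.comp (continuous_const_smul m)))
        (hcs _ fun x hx => by simp [hζR x hx])
    have hI5 : ∀ m : ℝ, Integrable fun x => w x * u (m • x) := fun m =>
      Continuous.integrable_of_hasCompactSupport (by fun_prop)
        (hcs _ fun x hx => by simp [hwR x hx])
    have hHd : H l - H 1
        = ∫ x, ζ x * (l • fderiv ℝ u (l • x) - fderiv ℝ u x) (gammaFlux γ u x) := by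
      simp_rw [hd] at hweak
      rw [integral_add hI1 hI3] at hweak
      rw [← sub_eq_iff_eq_add'] at hweak
      rw [← hweak, hH]
      simp only
      rw [← integral_sub (hI5 l) (hI5 1), ← integral_sub hI2 hI1]
      refine integral_congr_ae (Eventually.of_forall fun x => ?_)
      simp only [hw, one_smul]
      ring
    have hGd : (G l - G 1) / γ
        = ∫ x, ζ x * ((‖l • fderiv ℝ u (l • x)‖ ^ γ - ‖gradient u x‖ ^ γ) / γ) := by
      simp only [hG]
      rw [← integral_const_mul, ← integral_const_mul,
        ← integral_sub ((hI4 l).const_mul _) ((hI4 1).const_mul _), ← integral_div]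
      refine integral_congr_ae (Eventually.of_forall fun x => ?_)
      simp only [norm_smul, one_smul, Real.one_rpow, norm_gradient_eq]
      rw [Real.mul_rpow (norm_nonneg _) (norm_nonneg _), Real.norm_of_nonneg hl.le]
      ring
    have hle : H l - H 1 ≤ (G l - G 1) / γ := by
      rw [hHd, hGd]
      refine integral_mono hI3 ?_ fun x =>
        mul_le_mul_of_nonneg_left (apply_gammaFlux_sub_le hγ _ x) (hζ0 x)
      refine Continuous.integrable_of_hasCompactSupport ?_
        (hcs _ fun x hx => by simp [hζR x hx])
      refine hcζ.mul (Continuous.div_const (Continuous.sub ?_ hcgγ) _)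
      refine Continuous.rpow_const (by fun_prop) fun x => Or.inr (by linarith)
    rw [le_div_iff₀ (by linarith)] at hle
    linarith
  have hG' : HasDerivAt G (γ * (∫ x, ζ x * ‖gradient u x‖ ^ γ)
      + (-(n * ∫ x, ζ x * ‖gradient u x‖ ^ γ)
        - ∫ x, fderiv ℝ ζ x x * ‖gradient u x‖ ^ γ)) 1 := by
    have h1 := hasDerivAt_integral_comp_smul_of_hasCompactSupport volume hζ hζc hcgγ
    have h2 := (Real.hasDerivAt_rpow_const (x := 1) (p := γ) (Or.inl one_ne_zero)).mul h1
    rw [finrank_euclideanSpace_fin] at h2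
    simp only [one_smul, Real.one_rpow, mul_one, one_mul] at h2
    exact h2
  have hH' : HasDerivAt H (∫ x, w x * fderiv ℝ u x x) 1 :=
    hasDerivAt_integral_mul_comp_smul volume hcw hu.contDiff R fun x hx => Or.inl (hwR x hx)
  have hlm : IsLocalMin (fun l => G l - γ * H l) 1 := by
    filter_upwards [lt_mem_nhds (zero_lt_one : (0 : ℝ) < 1)] with l hl using hmin l hl
  have hzero := hlm.hasDerivAt_eq_zero (hG'.sub (hH'.const_mul γ))
  have hsplit : ∫ x, w x * fderiv ℝ u x x = (∫ x, ζ x * u x ^ p * fderiv ℝ u x x)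
      - ∫ x, fderiv ℝ u x x * fderiv ℝ ζ x (gammaFlux γ u x) := by
    rw [← integral_sub]
    · refine integral_congr_ae (Eventually.of_forall fun x => ?_)
      simp only [hw]
      ring
    · exact Continuous.integrable_of_hasCompactSupport (by fun_prop)
        (hcs _ fun x hx => by simp [hζR x hx])
    · exact Continuous.integrable_of_hasCompactSupport (by fun_prop)
        (hcs _ fun x hx => by simp [hζR' x hx])
  rw [← hsplit]
  linarith

end IsPositiveClassicalSolution

end Solution

/-! ### Cutoff functions -/

section Cutoff

variable {E : Type*} [NormedAddCommGroup E] [NormedSpace ℝ E]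

/-- A `C¹` cutoff between the balls of radii `R` and `2 R`, with gradient bound `C / R`. -/
structure IsCutoff (C R : ℝ) (ζ : E → ℝ) : Prop where
  contDiff : ContDiff ℝ 1 ζ
  hasCompactSupport : HasCompactSupport ζ
  nonneg : ∀ x, 0 ≤ ζ x
  le_one : ∀ x, ζ x ≤ 1
  eq_one : ∀ x, ‖x‖ ≤ R → ζ x = 1
  norm_fderiv_le : ∀ x, ‖fderiv ℝ ζ x‖ ≤ C / R
  fderiv_eq_zero : ∀ x, ‖x‖ < R → fderiv ℝ ζ x = 0
  fderiv_eq_zero' : ∀ x, 2 * R < ‖x‖ → fderiv ℝ ζ x = 0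

/-- One fixed bump is rescaled, which makes `C` independent of `R`. -/
theorem exists_isCutoff (E : Type*) [NormedAddCommGroup E] [InnerProductSpace ℝ E]
    [FiniteDimensional ℝ E] :
    ∃ C : ℝ, 0 ≤ C ∧ ∀ R : ℝ, 0 < R → ∃ ζ : E → ℝ, IsCutoff C R ζ := by
  let η : ContDiffBump (0 : E) := ⟨1, 2, one_pos, one_lt_two⟩
  have hη : ContDiff ℝ 1 η := η.contDiff
  obtain ⟨C, hC⟩ := (η.hasCompactSupport.fderiv ℝ).exists_bound_of_continuous
    (hη.continuous_fderiv (by norm_num))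
  refine ⟨C, (norm_nonneg _).trans (hC 0), fun R hR => ⟨fun x => η (R⁻¹ • x), ?_⟩⟩
  have hfd : ∀ x, fderiv ℝ (fun x => η (R⁻¹ • x)) x = R⁻¹ • fderiv ℝ η (R⁻¹ • x) := fun x =>
    fderiv_comp_smul _
  have hn : ∀ x : E, ‖R⁻¹ • x‖ = ‖x‖ / R := fun x => by
    rw [norm_smul, Real.norm_of_nonneg (inv_nonneg.2 hR.le), inv_mul_eq_div]
  refine ⟨by fun_prop, ?_, fun x => η.nonneg, fun x => η.le_one, fun x hx => ?_, fun x => ?_,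
    fun x hx => ?_, fun x hx => ?_⟩
  · exact η.hasCompactSupport.comp_smul (inv_ne_zero hR.ne')
  · apply η.one_of_mem_closedBall
    rw [mem_closedBall_zero_iff, hn]
    exact (div_le_one hR).2 hx
  · rw [hfd, norm_smul, Real.norm_of_nonneg (inv_nonneg.2 hR.le), inv_mul_eq_div]
    exact div_le_div_of_nonneg_right (hC _) hR.le
  · rw [hfd, (η.eventuallyEq_one_of_mem_ball ?_).fderiv_eq]
    · simp
    · rw [mem_ball_zero_iff, hn]
      exact (div_lt_one hR).2 hx
  · have : R⁻¹ • x ∉ tsupport η := by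
      rw [η.tsupport_eq, mem_closedBall_zero_iff, hn, not_le]
      exact (lt_div_iff₀ hR).2 hx
    rw [hfd, image_eq_zero_of_notMem_tsupport fun h => this (tsupport_fderiv_subset ℝ h),
      smul_zero]

/-- The scale `R` cancels, so this bound supplies dominating functions uniform in the cutoff for all
boundary terms. -/
theorem IsCutoff.norm_mul_norm_fderiv_le {C R : ℝ} {ζ : E → ℝ} (h : IsCutoff C R ζ)
    (hC : 0 ≤ C) (hR : 0 < R) (x : E) : ‖x‖ * ‖fderiv ℝ ζ x‖ ≤ 2 * C := by
  rcases le_or_gt ‖x‖ (2 * R) with hx | hx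
  · calc ‖x‖ * ‖fderiv ℝ ζ x‖ ≤ 2 * R * (C / R) :=
          mul_le_mul hx (h.norm_fderiv_le x) (norm_nonneg _) (by positivity)
      _ = 2 * C := by field_simp
  · rw [h.fderiv_eq_zero' x hx, norm_zero, mul_zero]
    positivity

end Cutoff

/-! ### Integration along rays and Hardy's inequality -/

section Hardy

open scoped ENNReal

/-- Hölder applied to f = (t^(a/γ) f) · t^(-a/γ). The condition on `a` says exactly that the
conjugate power t^(-a/(γ-1)) is integrable at infinity. -/
theorem exists_rpow_lintegral_Ioi_le {γ a : ℝ} (hγ : 1 < γ) (ha : γ - 1 < a) :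
    ∃ K : ℝ≥0∞, K ≠ ∞ ∧ ∀ f : ℝ → ℝ≥0∞, Measurable f →
      (∫⁻ t in Ioi 1, f t) ^ γ ≤ K * ∫⁻ t in Ioi 1, ENNReal.ofReal (t ^ a) * f t ^ γ := by
  have hγ0 : 0 < γ := by linarith
  have hq : γ.HolderConjugate (Real.conjExponent γ) := Real.HolderConjugate.conjExponent hγ
  set q := Real.conjExponent γ
  have hqe : q = γ / (γ - 1) := rfl
  have hexp : -(a / γ) * q < -1 := by
    rw [hqe, neg_mul, neg_lt_neg_iff, div_mul_div_cancel₀ hγ0.ne', lt_div_iff₀ (by linarith)]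
    linarith
  set K0 := ∫⁻ t in Ioi (1 : ℝ), ENNReal.ofReal (t ^ (-(a / γ))) ^ q
  have hK0 : K0 ≠ ∞ := by
    have h := (integrableOn_Ioi_rpow_of_lt hexp one_pos).lintegral_lt_top
    refine (lt_of_eq_of_lt (setLIntegral_congr_fun measurableSet_Ioi fun t ht => ?_) h).ne
    have ht0 : 0 < t := zero_lt_one.trans ht
    rw [ENNReal.ofReal_rpow_of_pos (by positivity), ← Real.rpow_mul ht0.le]
  refine ⟨K0 ^ (1 / q * γ), ENNReal.rpow_ne_top_of_nonneg
    (mul_nonneg (one_div_nonneg.2 hq.symm.nonneg) hγ0.le) hK0, fun f hf => ?_⟩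
  have h := ENNReal.lintegral_mul_le_Lp_mul_Lq (volume.restrict (Ioi (1 : ℝ))) hq
    (f := fun t => ENNReal.ofReal (t ^ (a / γ)) * f t)
    (g := fun t => ENNReal.ofReal (t ^ (-(a / γ)))) (by fun_prop) (by fun_prop)
  have e1 : ∫⁻ t in Ioi (1 : ℝ), ((fun t => ENNReal.ofReal (t ^ (a / γ)) * f t)
      * fun t => ENNReal.ofReal (t ^ (-(a / γ)))) t = ∫⁻ t in Ioi 1, f t := by
    refine setLIntegral_congr_fun measurableSet_Ioi fun t ht => ?_
    have ht0 : 0 < t := zero_lt_one.trans ht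
    simp only [Pi.mul_apply]
    rw [mul_right_comm, ← ENNReal.ofReal_mul (by positivity), ← Real.rpow_add ht0]
    simp
  have e2 : ∫⁻ t in Ioi (1 : ℝ), (ENNReal.ofReal (t ^ (a / γ)) * f t) ^ γ
      = ∫⁻ t in Ioi 1, ENNReal.ofReal (t ^ a) * f t ^ γ := by
    refine setLIntegral_congr_fun measurableSet_Ioi fun t ht => ?_
    have ht0 : 0 < t := zero_lt_one.trans ht
    rw [ENNReal.mul_rpow_of_nonneg _ _ hγ0.le, ENNReal.ofReal_rpow_of_pos (by positivity),
      ← Real.rpow_mul ht0.le, div_mul_cancel₀ _ hγ0.ne']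
  rw [e1, e2] at h
  calc (∫⁻ t in Ioi 1, f t) ^ γ
      ≤ ((∫⁻ t in Ioi 1, ENNReal.ofReal (t ^ a) * f t ^ γ) ^ (1 / γ) * K0 ^ (1 / q)) ^ γ :=
        ENNReal.rpow_le_rpow h hγ0.le
    _ = _ := by
        rw [ENNReal.mul_rpow_of_nonneg _ _ hγ0.le, ← ENNReal.rpow_mul, ← ENNReal.rpow_mul,
          one_div_mul_cancel hγ0.ne', ENNReal.rpow_one, mul_comm]

theorem hasDerivAt_comp_smul {E : Type*} [NormedAddCommGroup E] [NormedSpace ℝ E] {u : E → ℝ}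
    (hu : ContDiff ℝ 1 u) (x : E) (t : ℝ) :
    HasDerivAt (fun t : ℝ => u (t • x)) (fderiv ℝ u (t • x) x) t := by
  have h1 : HasDerivAt (fun t : ℝ => t • x) x t := by
    simpa using (hasDerivAt_id t).smul_const x
  exact ((hu.differentiable (by norm_num)) (t • x)).hasFDerivAt.comp_hasDerivAt t h1

theorem integrableOn_fderiv_smul_apply {E : Type*} [NormedAddCommGroup E] [NormedSpace ℝ E]
    [FiniteDimensional ℝ E] {u : E → ℝ} (hu : ContDiff ℝ 1 u) {x : E}
    (hx : ∫⁻ t in Ioi (1 : ℝ), ‖fderiv ℝ u (t • x)‖ₑ ≠ ∞) :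
    IntegrableOn (fun t : ℝ => fderiv ℝ u (t • x) x) (Ioi 1) := by
  have hc : Continuous (fderiv ℝ u) := hu.continuous_fderiv (by norm_num)
  have h1 : IntegrableOn (fun t : ℝ => fderiv ℝ u (t • x)) (Ioi 1) :=
    ⟨Continuous.aestronglyMeasurable (by fun_prop), hx.lt_top⟩
  exact ContinuousLinearMap.integrable_comp (ContinuousLinearMap.apply ℝ ℝ x) h1

variable {E : Type*} [NormedAddCommGroup E] [NormedSpace ℝ E] [FiniteDimensional ℝ E]
  [MeasurableSpace E] [BorelSpace E] (μ : Measure E) [μ.IsAddHaarMeasure]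

theorem lintegral_comp_smul_of_pos {h : E → ℝ≥0∞} (hh : Measurable h) {t : ℝ} (ht : 0 < t) :
    ∫⁻ x, h (t • x) ∂μ
      = ENNReal.ofReal (t ^ (-(Module.finrank ℝ E : ℝ))) * ∫⁻ x, h x ∂μ := by
  rw [← lintegral_map hh (measurable_const_smul t), Measure.map_addHaar_smul μ ht.ne',
    lintegral_smul_measure, abs_of_pos (by positivity), smul_eq_mul, Real.rpow_neg ht.le,
    Real.rpow_natCast]

/-- By Tonelli and scaling, with d the dimension, the integral equals ∫ h times ∫ t^(a-d) over (1,
∞), which converges since a - d < -1. -/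
theorem lintegral_lintegral_Ioi_comp_smul_lt_top {a : ℝ} (ha : a + 1 < Module.finrank ℝ E)
    {h : E → ℝ≥0∞} (hh : Measurable h) (hfin : ∫⁻ x, h x ∂μ ≠ ∞) :
    ∫⁻ x, ∫⁻ t in Ioi (1 : ℝ), ENNReal.ofReal (t ^ a) * h (t • x) ∂volume ∂μ ≠ ∞ := by
  rw [lintegral_lintegral_swap (by fun_prop)]
  have e : ∫⁻ t in Ioi (1 : ℝ), ∫⁻ x, ENNReal.ofReal (t ^ a) * h (t • x) ∂μ
      = ∫⁻ t in Ioi (1 : ℝ),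
        ENNReal.ofReal (t ^ (a - Module.finrank ℝ E)) * ∫⁻ x, h x ∂μ := by
    refine setLIntegral_congr_fun measurableSet_Ioi fun t ht => ?_
    have ht0 : 0 < t := zero_lt_one.trans ht
    rw [lintegral_const_mul _ (by fun_prop), lintegral_comp_smul_of_pos μ hh ht0, ← mul_assoc,
      ← ENNReal.ofReal_mul (by positivity), ← Real.rpow_add ht0, ← sub_eq_add_neg]
  rw [e, lintegral_mul_const _ (by fun_prop)]
  exact ENNReal.mul_ne_top
    (integrableOn_Ioi_rpow_of_lt (by linarith) one_pos).lintegral_lt_top.ne hfin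

variable {γ : ℝ} {u : E → ℝ}

/-- Radial integration: the derivative of `u` along almost every ray is integrable, with a
`γ`-integrable bound. -/
theorem exists_radial_bound (hγ : 1 < γ) (hγd : γ < Module.finrank ℝ E) (hu : ContDiff ℝ 1 u)
    (hE : ∫⁻ x, ‖fderiv ℝ u x‖ₑ ^ γ ∂μ ≠ ∞) :
    ∫⁻ x, (∫⁻ t in Ioi (1 : ℝ), ‖fderiv ℝ u (t • x)‖ₑ) ^ γ ∂μ ≠ ∞ := by
  have hm : Measurable (fderiv ℝ u) := (hu.continuous_fderiv (by norm_num)).measurable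
  -- With d the dimension, Hölder needs a > γ - 1 and Tonelli needs a < d - 1. The midpoint is
  -- chosen; the interval is nonempty because γ < d.
  obtain ⟨K, hK, h⟩ := exists_rpow_lintegral_Ioi_le hγ
    (show γ - 1 < (γ + Module.finrank ℝ E - 2) / 2 by linarith)
  have h2 := lintegral_lintegral_Ioi_comp_smul_lt_top μ
    (show (γ + Module.finrank ℝ E - 2) / 2 + 1 < Module.finrank ℝ E by linarith)
    (h := fun x => ‖fderiv ℝ u x‖ₑ ^ γ) (by fun_prop) hE
  refine ((lintegral_mono fun x => h (fun t => ‖fderiv ℝ u (t • x)‖ₑ) (by fun_prop)).trans_lt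
    ?_).ne
  rw [lintegral_const_mul' _ _ hK]
  exact ENNReal.mul_lt_top hK.lt_top h2.lt_top

theorem ae_lintegral_Ioi_ne_top (hγ : 1 < γ) (hγd : γ < Module.finrank ℝ E)
    (hu : ContDiff ℝ 1 u) (hE : ∫⁻ x, ‖fderiv ℝ u x‖ₑ ^ γ ∂μ ≠ ∞) :
    ∀ᵐ x ∂μ, ∫⁻ t in Ioi (1 : ℝ), ‖fderiv ℝ u (t • x)‖ₑ ≠ ∞ := by
  have hm : Measurable (fderiv ℝ u) := (hu.continuous_fderiv (by norm_num)).measurable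
  have h := ae_lt_top' (Measurable.aemeasurable ?_) (exists_radial_bound μ hγ hγd hu hE)
  · filter_upwards [h] with x hx htop
    rw [htop, ENNReal.top_rpow_of_pos (by linarith)] at hx
    exact lt_irrefl _ hx
  · refine Measurable.pow_const ?_ γ
    exact Measurable.lintegral_prod_right' (f := fun z : E × ℝ => ‖fderiv ℝ u (z.2 • z.1)‖ₑ)
      (by fun_prop)

/-- **Hardy's inequality**, in qualitative form. -/
theorem integrable_div_norm_rpow (hγ : 1 < γ) (hγd : γ < Module.finrank ℝ E)
    (hu : ContDiff ℝ 1 u) (hE : ∫⁻ x, ‖fderiv ℝ u x‖ₑ ^ γ ∂μ ≠ ∞)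
    (h0 : ∀ᵐ x ∂μ, Tendsto (fun t : ℝ => u (t • x)) atTop (𝓝 0)) :
    Integrable (fun x => (|u x| / ‖x‖) ^ γ) μ := by
  have hcu := hu.continuous
  refine ⟨Measurable.aestronglyMeasurable (by fun_prop), ?_⟩
  refine lt_of_le_of_lt (lintegral_mono_ae ?_) (exists_radial_bound μ hγ hγd hu hE).lt_top
  filter_upwards [h0, ae_lintegral_Ioi_ne_top μ hγ hγd hu hE] with x hx hfin
  have hint := integrableOn_fderiv_smul_apply hu hfin
  -- As u vanishes at the end of the ray, u(x) = -∫ Du(t x) x dt over (1, ∞).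
  have h1 := integral_Ioi_of_hasDerivAt_of_tendsto' (a := 1)
    (fun t _ => hasDerivAt_comp_smul hu x t) hint hx
  rw [one_smul, zero_sub] at h1
  have h2 : ‖u x‖ₑ ≤ ‖x‖ₑ * ∫⁻ t in Ioi (1 : ℝ), ‖fderiv ℝ u (t • x)‖ₑ := by
    rw [← enorm_neg, ← h1, ← lintegral_const_mul' _ _ enorm_ne_top]
    refine (enorm_integral_le_lintegral_enorm _).trans (lintegral_mono fun t => ?_)
    rw [mul_comm]
    exact ContinuousLinearMap.le_opENorm _ _
  rw [Real.enorm_rpow_of_nonneg (by positivity) (by linarith)]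
  refine ENNReal.rpow_le_rpow ?_ (by linarith)
  rcases eq_or_ne x 0 with rfl | hx0
  · simp
  · rw [div_eq_mul_inv, enorm_mul, enorm_inv (norm_ne_zero_iff.2 hx0), enorm_norm,
      Real.enorm_abs, ← div_eq_mul_inv]
    exact ENNReal.div_le_of_le_mul' h2

end Hardy

/-! ### Necessity of the critical exponent -/

section Nonexistence

variable {n : ℕ} {γ p : ℝ} {u : EuclideanSpace ℝ (Fin n) → ℝ}

namespace IsPositiveClassicalSolution

/-- Up to a constant, the left side is the average of u^p over the ball of radius k r. Testing the
equation with a cutoff bounds ∫ u^p there by C/(k r) times ∫ |∇u|^(γ-1) over the double ball, which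
is O(k^n) because |∇u|^(γ-1) ≤ |∇u|^γ + 1. -/
theorem exists_setIntegral_rpow_comp_smul_le (hγ : 1 < γ)
    (hu : IsPositiveClassicalSolution γ p u) (hE : Integrable fun x => ‖gradient u x‖ ^ γ)
    {r : ℝ} (hr : 0 < r) :
    ∃ K : ℝ, ∀ k : ℝ, 1 ≤ k →
      ∫ x in Metric.closedBall 0 r, u (k • x) ^ p ≤ K / k := by
  obtain ⟨C, hC, hζ⟩ := exists_isCutoff (EuclideanSpace ℝ (Fin n))
  set I := ∫ x, ‖gradient u x‖ ^ γ
  have hI : 0 ≤ I := integral_nonneg fun x => by positivity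
  set ω := volume.real (Metric.closedBall (0 : EuclideanSpace ℝ (Fin n)) 1)
  refine ⟨C / r * (I + (2 * r) ^ n * ω), fun k hk => ?_⟩
  have hk0 : 0 < k := by linarith
  obtain ⟨ζ, hζ⟩ := hζ (k * r) (by positivity)
  have hcup := (hu.contDiff_rpow p).continuous
  have hcζ := hζ.contDiff.continuous
  have hpos : ∀ x, 0 ≤ u x ^ p := fun x => Real.rpow_nonneg (hu.pos x).le p
  have hint : Integrable fun x => ζ x * u x ^ p :=
    Continuous.integrable_of_hasCompactSupport (by fun_prop) hζ.hasCompactSupport.mul_right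
  rw [Measure.setIntegral_comp_smul_of_pos volume (fun x => u x ^ p) _ hk0,
    smul_closedBall _ _ hr.le, smul_zero, Real.norm_of_nonneg hk0.le, finrank_euclideanSpace_fin,
    smul_eq_mul]
  have h1 : ∫ x in Metric.closedBall 0 (k * r), u x ^ p ≤ ∫ x, ζ x * u x ^ p := by
    rw [← integral_indicator measurableSet_closedBall]
    refine integral_mono_of_nonneg (Eventually.of_forall fun x => indicator_nonneg
      (fun x _ => hpos x) x) hint (Eventually.of_forall fun x => ?_)
    by_cases hx : x ∈ Metric.closedBall 0 (k * r)
    · simp only [indicator_of_mem hx]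
      rw [hζ.eq_one x (by simpa using hx), one_mul]
    · simp only [indicator_of_notMem hx]
      exact mul_nonneg (hζ.nonneg x) (hpos x)
  have h2 : ∫ x, ζ x * u x ^ p
      ≤ C / (k * r) * (I + (2 * (k * r)) ^ n * ω) := by
    rw [hu.integral_mul_rpow_eq hζ.contDiff hζ.hasCompactSupport]
    set S := Metric.closedBall (0 : EuclideanSpace ℝ (Fin n)) (2 * (k * r))
    have hSfin : volume S ≠ ⊤ := measure_closedBall_lt_top.ne
    have hSint : Integrable (S.indicator fun _ => (1 : ℝ)) :=
      (integrable_indicator_iff measurableSet_closedBall).2 (integrableOn_const hSfin)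
    have hS : ∫ x, S.indicator (fun _ => (1 : ℝ)) x = (2 * (k * r)) ^ n * ω := by
      rw [integral_indicator measurableSet_closedBall, setIntegral_const, smul_eq_mul, mul_one,
        Measure.addHaar_real_closedBall' _ _ (by positivity), finrank_euclideanSpace_fin]
    rw [← hS, ← integral_add hE hSint, ← integral_const_mul]
    refine integral_mono ?_ ((hE.add hSint).const_mul _) fun x => ?_
    · have hcζ' : Continuous (fderiv ℝ ζ) := hζ.contDiff.continuous_fderiv (by norm_num)
      have hcV := hu.contDiff_flux.continuous
      have hζc' : HasCompactSupport (fderiv ℝ ζ) := hζ.hasCompactSupport.fderiv ℝ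
      exact Continuous.integrable_of_hasCompactSupport (by fun_prop)
        (hζc'.mono fun x hx h0 => hx (by simp [h0]))
    · by_cases hx : x ∈ S
      · rw [indicator_of_mem hx]
        refine ((le_abs_self _).trans (abs_apply_gammaFlux_le hγ _ x)).trans ?_
        refine mul_le_mul (hζ.norm_fderiv_le x) ?_ (by positivity) (by positivity)
        rcases le_or_gt ‖gradient u x‖ 1 with h | h
        · have := Real.rpow_le_one (norm_nonneg _) h (by linarith : 0 ≤ γ - 1)
          have : 0 ≤ ‖gradient u x‖ ^ γ := by positivity
          linarith
        · have := Real.rpow_le_rpow_of_exponent_le h.le (by linarith : γ - 1 ≤ γ)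
          linarith
      · rw [hζ.fderiv_eq_zero' x (by simpa [S] using hx), indicator_of_notMem hx]
        simp only [zero_apply]
        positivity
  have hkn : 1 ≤ k ^ n := one_le_pow₀ hk
  calc (k ^ n)⁻¹ * ∫ x in Metric.closedBall 0 (k * r), u x ^ p
      ≤ (k ^ n)⁻¹ * (C / (k * r) * (k ^ n * I + (2 * (k * r)) ^ n * ω)) := by
        gcongr
        refine h1.trans (h2.trans ?_)
        gcongr
        exact le_mul_of_one_le_left hI hkn
    _ = C / r * (I + (2 * r) ^ n * ω) / k := by
        rw [show 2 * (k * r) = k * (2 * r) by ring, mul_pow k]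
        field_simp

/-- By Fatou on each ball, the O(1/k) bound gives lim inf u(k x)^p = 0 almost everywhere, whatever
the sign of p. -/
theorem ae_frequently_rpow_comp_smul_lt (hγ : 1 < γ)
    (hu : IsPositiveClassicalSolution γ p u) (hE : Integrable fun x => ‖gradient u x‖ ^ γ) :
    ∀ᵐ x, ∀ ε : ℝ, 0 < ε → ∃ᶠ k : ℕ in atTop, u ((k : ℝ) • x) ^ p < ε := by
  have hcup := (hu.contDiff_rpow p).continuous
  have hpos : ∀ x, 0 ≤ u x ^ p := fun x => Real.rpow_nonneg (hu.pos x).le p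
  have key : ∀ r : ℕ, ∀ᵐ x, x ∈ Metric.closedBall (0 : EuclideanSpace ℝ (Fin n)) (r + 1) →
      liminf (fun k : ℕ => ENNReal.ofReal (u ((k : ℝ) • x) ^ p)) atTop = 0 := by
    intro r
    obtain ⟨K, hK⟩ := hu.exists_setIntegral_rpow_comp_smul_le hγ hE
      (by positivity : (0 : ℝ) < r + 1)
    rw [← ae_restrict_iff' measurableSet_closedBall]
    have hm : ∀ k : ℕ, Measurable fun x => ENNReal.ofReal (u ((k : ℝ) • x) ^ p) := fun k =>
      (hcup.comp (continuous_const_smul (k : ℝ))).measurable.ennreal_ofReal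
    have hlim : Tendsto (fun k : ℕ => ∫⁻ x in
        Metric.closedBall (0 : EuclideanSpace ℝ (Fin n)) (r + 1),
        ENNReal.ofReal (u ((k : ℝ) • x) ^ p)) atTop (𝓝 0) := by
      have hb : Tendsto (fun k : ℕ => ENNReal.ofReal (K / k)) atTop (𝓝 0) := by
        have := ENNReal.tendsto_ofReal (tendsto_const_div_atTop_nhds_zero_nat K)
        rwa [ENNReal.ofReal_zero] at this
      refine tendsto_of_tendsto_of_tendsto_of_le_of_le' tendsto_const_nhds hb
        (Eventually.of_forall fun _ => zero_le) ?_
      filter_upwards [eventually_ge_atTop 1] with k hk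
      rw [← ofReal_integral_eq_lintegral_ofReal]
      · exact ENNReal.ofReal_le_ofReal (hK k (by exact_mod_cast hk))
      · exact (hcup.comp (continuous_const_smul (k : ℝ))).continuousOn.integrableOn_compact
          (isCompact_closedBall _ _)
      · exact Eventually.of_forall fun x => hpos _
    have h0 := lintegral_liminf_le (μ := volume.restrict
      (Metric.closedBall (0 : EuclideanSpace ℝ (Fin n)) (r + 1))) (u := atTop) hm
    rw [hlim.liminf_eq, nonpos_iff_eq_zero,
      lintegral_eq_zero_iff (Measurable.liminf hm)] at h0
    exact h0
  filter_upwards [ae_all_iff.2 key] with x hx ε hε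
  obtain ⟨r, hr⟩ := exists_nat_ge ‖x‖
  have h := hx r (by rw [mem_closedBall_zero_iff]; linarith)
  by_contra hne
  rw [not_frequently] at hne
  have hle : ENNReal.ofReal ε
      ≤ liminf (fun k : ℕ => ENNReal.ofReal (u ((k : ℝ) • x) ^ p)) atTop :=
    le_liminf_of_le (by isBoundedDefault) (hne.mono fun k hk =>
      ENNReal.ofReal_le_ofReal (not_lt.1 hk))
  rw [h, nonpos_iff_eq_zero, ENNReal.ofReal_eq_zero] at hle
  linarith

theorem lintegral_fderiv_rpow_ne_top (hγ : 1 < γ)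
    (hE : Integrable fun x => ‖gradient u x‖ ^ γ) :
    ∫⁻ x, ‖fderiv ℝ u x‖ₑ ^ γ ≠ ⊤ := by
  refine (lt_of_eq_of_lt (lintegral_congr fun x => ?_) hE.2).ne
  rw [Real.enorm_rpow_of_nonneg (by positivity) (by linarith), norm_gradient_eq, enorm_norm]

/-- A finite energy solution has limit `0` along almost every ray, and the exponent is positive. -/
theorem exponent_pos_and_ae_tendsto (hγ : 1 < γ) (hγn : γ < n)
    (hu : IsPositiveClassicalSolution γ p u) (hE : Integrable fun x => ‖gradient u x‖ ^ γ) :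
    0 < p ∧ ∀ᵐ x, Tendsto (fun t : ℝ => u (t • x)) atTop (𝓝 0) := by
  have key : ∀ᵐ x, 0 < p ∧ Tendsto (fun t : ℝ => u (t • x)) atTop (𝓝 0) := by
    filter_upwards [hu.ae_frequently_rpow_comp_smul_lt hγ hE,
      ae_lintegral_Ioi_ne_top volume hγ (by rwa [finrank_euclideanSpace_fin]) hu.contDiff
        (lintegral_fderiv_rpow_ne_top hγ hE)] with x hx hfin
    have hlim := tendsto_limUnder_of_hasDerivAt_of_integrableOn_Ioi (a := 1)
      (fun t _ => hasDerivAt_comp_smul hu.contDiff x t)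
      (integrableOn_fderiv_smul_apply hu.contDiff hfin)
    set m := limUnder atTop fun t : ℝ => u (t • x)
    have hlimN : Tendsto (fun k : ℕ => u ((k : ℝ) • x)) atTop (𝓝 m) :=
      hlim.comp tendsto_natCast_atTop_atTop
    have hm : 0 ≤ m := ge_of_tendsto' hlim fun t => (hu.pos _).le
    -- If p ≤ 0, the eventual bound u < m + 1 along the ray keeps u^p at least (m+1)^p, against the
    -- vanishing lim inf.
    have hp : 0 < p := by
      by_contra hp
      have h1 := hlimN.eventually (gt_mem_nhds (lt_add_one m))
      obtain ⟨k, hk, hk'⟩ := ((hx ((m + 1) ^ p) (by positivity)).and_eventually h1).exists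
      exact absurd hk (not_lt.2 (Real.rpow_le_rpow_of_nonpos (hu.pos _) hk'.le (not_lt.1 hp)))
    refine ⟨hp, ?_⟩
    rcases hm.eq_or_lt with h0 | h0
    · rwa [← h0] at hlim
    -- A positive limit would keep u^p above (m/2)^p eventually.
    · have h1 := hlimN.eventually (lt_mem_nhds (half_lt_self h0))
      obtain ⟨k, hk, hk'⟩ := ((hx ((m / 2) ^ p) (by positivity)).and_eventually h1).exists
      exact absurd hk (not_lt.2 (Real.rpow_le_rpow (by positivity) hk'.le hp.le))
  -- The sign of `p` does not depend on the ray, so a single good ray suffices.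
  exact ⟨key.exists.choose_spec.1, key.mono fun x hx => hx.2⟩

end IsPositiveClassicalSolution

theorem tendsto_integral_mul_of_eventually_eq {α : Type*} [MeasurableSpace α] {μ : Measure α}
    {b : ℕ → α → ℝ} {F : α → ℝ} {K c : ℝ} (hF : Integrable F μ)
    (hb : ∀ k, AEStronglyMeasurable (b k) μ) (hK : ∀ k x, |b k x| ≤ K)
    (hc : ∀ x, ∀ᶠ k in atTop, b k x = c) :
    Tendsto (fun k => ∫ x, b k x * F x ∂μ) atTop (𝓝 (c * ∫ x, F x ∂μ)) := by
  rw [← integral_const_mul]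
  refine tendsto_integral_of_dominated_convergence (fun x => K * |F x|)
    (fun k => (hb k).mul hF.aestronglyMeasurable) (hF.abs.const_mul K) (fun k => ?_) ?_
  · refine Eventually.of_forall fun x => ?_
    rw [norm_mul]
    exact mul_le_mul_of_nonneg_right (hK k x) (norm_nonneg _)
  · refine Eventually.of_forall fun x => tendsto_const_nhds.congr' ?_
    filter_upwards [hc x] with k hk
    rw [hk]

/-- A finite energy solution has the critical exponent. -/
theorem IsPositiveClassicalSolution.exponent_eq (hγ : 1 < γ) (hγn : γ < n)
    (hu : IsPositiveClassicalSolution γ p u) (hE : Integrable fun x => ‖gradient u x‖ ^ γ) :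
    p = n * γ / (n - γ) - 1 := by
  obtain ⟨hp, htend⟩ := hu.exponent_pos_and_ae_tendsto hγ hγn hE
  have hhardy := integrable_div_norm_rpow volume hγ (by rwa [finrank_euclideanSpace_fin])
    hu.contDiff (lintegral_fderiv_rpow_ne_top hγ hE) htend
  obtain ⟨C, hC, hex⟩ := exists_isCutoff (EuclideanSpace ℝ (Fin n))
  -- The radius k + 1 is positive also for k = 0.
  choose ζ hζ using fun k : ℕ => hex (k + 1) (by positivity)
  have hcu := hu.contDiff.continuous
  have hcu' : Continuous (fderiv ℝ u) := hu.contDiff.continuous_fderiv (by norm_num)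
  have hcV := hu.contDiff_flux.continuous
  have hcup := (hu.contDiff_rpow (p + 1)).continuous
  have hcζ : ∀ k, Continuous (ζ k) := fun k => (hζ k).contDiff.continuous
  have hcζ' : ∀ k, Continuous (fderiv ℝ (ζ k)) := fun k =>
    (hζ k).contDiff.continuous_fderiv (by norm_num)
  have hζev : ∀ x, ∀ᶠ k in atTop, ζ k x = 1 := fun x => by
    obtain ⟨N, hN⟩ := exists_nat_ge ‖x‖
    filter_upwards [eventually_ge_atTop N] with k hk
    have : (N : ℝ) ≤ k := by exact_mod_cast hk
    exact (hζ k).eq_one x (by linarith)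
  have hζev' : ∀ x, ∀ᶠ k in atTop, fderiv ℝ (ζ k) x = 0 := fun x => by
    obtain ⟨N, hN⟩ := exists_nat_ge ‖x‖
    filter_upwards [eventually_ge_atTop N] with k hk
    have : (N : ℝ) ≤ k := by exact_mod_cast hk
    exact (hζ k).fderiv_eq_zero x (by linarith)
  have hζabs : ∀ k x, |ζ k x| ≤ 1 := fun k x => by
    rw [abs_of_nonneg ((hζ k).nonneg x)]
    exact (hζ k).le_one x
  have hζ2C : ∀ k x, ‖x‖ * ‖fderiv ℝ (ζ k) x‖ ≤ 2 * C := fun k x =>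
    (hζ k).norm_mul_norm_fderiv_le hC (by positivity) x
  have hζx : ∀ k x, |fderiv ℝ (ζ k) x x| ≤ 2 * C := fun k x => by
    refine ((fderiv ℝ (ζ k) x).le_opNorm x).trans ?_
    rw [mul_comm]
    exact hζ2C k x
  have hV0 : ∀ x, 0 ≤ ‖gradient u x‖ := fun x => norm_nonneg _
  set I := ∫ x, ‖gradient u x‖ ^ γ
  have hζE : Tendsto (fun k => ∫ x, ζ k x * ‖gradient u x‖ ^ γ) atTop (𝓝 I) := by
    simpa using tendsto_integral_mul_of_eventually_eq hE
      (fun k => (hcζ k).aestronglyMeasurable) hζabs hζev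
  -- the boundary term of the energy identity
  have hB1 : Tendsto (fun k => ∫ x, u x * fderiv ℝ (ζ k) x (gammaFlux γ u x)) atTop (𝓝 0) := by
    rw [← integral_zero (EuclideanSpace ℝ (Fin n)) ℝ (μ := volume)]
    refine tendsto_integral_of_dominated_convergence
      (fun x => 2 * C * ((|u x| / ‖x‖) ^ γ + ‖gradient u x‖ ^ γ))
      (fun k => Continuous.aestronglyMeasurable (by have := hcζ' k; fun_prop))
      ((hhardy.add hE).const_mul _) (fun k => Eventually.of_forall fun x => ?_)
      (Eventually.of_forall fun x => tendsto_const_nhds.congr' ?_)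
    · have hR : 0 ≤ 2 * C * ((|u x| / ‖x‖) ^ γ + ‖gradient u x‖ ^ γ) := by positivity
      rcases eq_or_ne x 0 with rfl | hx
      · rw [(hζ k).fderiv_eq_zero 0 (by rw [norm_zero]; positivity)]
        simpa using hR
      have hx' : 0 < ‖x‖ := norm_pos_iff.2 hx
      have hq : γ.HolderConjugate (Real.conjExponent γ) := Real.HolderConjugate.conjExponent hγ
      have hY := Real.young_inequality_of_nonneg (a := |u x| / ‖x‖) (by positivity)
        (Real.rpow_nonneg (hV0 x) (γ - 1)) hq
      -- Young's inequality splits (|u|/|x|) |∇u|^(γ-1) into the Hardy integrand and the energy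
      -- density, both integrable.
      rw [← Real.rpow_mul (hV0 x), hq.sub_one_mul_conj] at hY
      have hY1 := div_le_self (by positivity : 0 ≤ (|u x| / ‖x‖) ^ γ) hγ.le
      have hY2 := div_le_self (by positivity : 0 ≤ ‖gradient u x‖ ^ γ) hq.symm.lt.le
      calc ‖u x * fderiv ℝ (ζ k) x (gammaFlux γ u x)‖
          ≤ |u x| * (‖fderiv ℝ (ζ k) x‖ * ‖gradient u x‖ ^ (γ - 1)) := by
            rw [norm_mul, Real.norm_eq_abs, Real.norm_eq_abs]
            gcongr
            exact abs_apply_gammaFlux_le hγ _ x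
        _ = ‖x‖ * ‖fderiv ℝ (ζ k) x‖ * (|u x| / ‖x‖ * ‖gradient u x‖ ^ (γ - 1)) := by
            field_simp
        _ ≤ 2 * C * ((|u x| / ‖x‖) ^ γ + ‖gradient u x‖ ^ γ) := by
            refine mul_le_mul (hζ2C k x) (by linarith) (by positivity) (by positivity)
    · filter_upwards [hζev' x] with k hk
      simp [hk]
  have hζU : Tendsto (fun k => ∫ x, ζ k x * u x ^ (p + 1)) atTop (𝓝 I) := by
    simp_rw [fun k => hu.integral_mul_rpow_add_one hγ (hζ k).contDiff (hζ k).hasCompactSupport]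
    simpa using hζE.add hB1
  have hUpos : ∀ x, 0 < u x ^ (p + 1) := fun x => Real.rpow_pos_of_pos (hu.pos x) _
  -- Integrability is a conclusion: as ζ k = 1 on the ball of radius k, the integrals over balls are
  -- eventually at most I + 1.
  have hU : Integrable fun x => u x ^ (p + 1) := by
    refine (aecover_ball (x := (0 : EuclideanSpace ℝ (Fin n)))
      (tendsto_natCast_atTop_atTop (R := ℝ))).integrable_of_integral_bounded_of_nonneg_ae (I + 1)
      (fun k => ?_) (Eventually.of_forall fun x => (hUpos x).le) ?_
    · exact (hcup.continuousOn.integrableOn_compact (isCompact_closedBall _ _)).mono_set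
        Metric.ball_subset_closedBall
    · filter_upwards [hζU.eventually (gt_mem_nhds (lt_add_one I))] with k hk
      refine le_trans ?_ hk.le
      rw [← integral_indicator Metric.isOpen_ball.measurableSet]
      refine integral_mono_of_nonneg (Eventually.of_forall fun x => indicator_nonneg
        (fun x _ => (hUpos x).le) x) ?_ (Eventually.of_forall fun x => ?_)
      · exact Continuous.integrable_of_hasCompactSupport ((hcζ k).mul hcup)
          (hζ k).hasCompactSupport.mul_right
      · by_cases hx : x ∈ Metric.ball (0 : EuclideanSpace ℝ (Fin n)) k
        · simp only [indicator_of_mem hx]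
          rw [mem_ball_zero_iff] at hx
          rw [(hζ k).eq_one x (by linarith), one_mul]
        · simp only [indicator_of_notMem hx]
          exact mul_nonneg ((hζ k).nonneg x) (hUpos x).le
  have hUI : ∫ x, u x ^ (p + 1) = I := by
    refine tendsto_nhds_unique ?_ hζU
    simpa using tendsto_integral_mul_of_eventually_eq hU
      (fun k => (hcζ k).aestronglyMeasurable) hζabs hζev
  have hIpos : 0 < I := by
    rw [← hUI]
    exact integral_pos_of_integrable_nonneg_nonzero hcup hU (fun x => (hUpos x).le)
      (hUpos 0).ne'
  have hxm : ∀ k, AEStronglyMeasurable (fun x => fderiv ℝ (ζ k) x x) := fun k =>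
    Continuous.aestronglyMeasurable (by have := hcζ' k; fun_prop)
  have hxev : ∀ x, ∀ᶠ k in atTop, fderiv ℝ (ζ k) x x = 0 := fun x => by
    filter_upwards [hζev' x] with k hk
    simp [hk]
  have hB2 : Tendsto (fun k => ∫ x, fderiv ℝ (ζ k) x x * ‖gradient u x‖ ^ γ) atTop (𝓝 0) := by
    simpa using tendsto_integral_mul_of_eventually_eq hE hxm hζx hxev
  have hB3 : Tendsto (fun k => ∫ x, fderiv ℝ (ζ k) x x * u x ^ (p + 1)) atTop (𝓝 0) := by
    simpa using tendsto_integral_mul_of_eventually_eq hU hxm hζx hxev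
  -- the boundary term of the Pohozaev identity
  have hB4 : Tendsto (fun k => ∫ x, fderiv ℝ u x x * fderiv ℝ (ζ k) x (gammaFlux γ u x))
      atTop (𝓝 0) := by
    rw [← integral_zero (EuclideanSpace ℝ (Fin n)) ℝ (μ := volume)]
    refine tendsto_integral_of_dominated_convergence
      (fun x => 2 * C * ‖gradient u x‖ ^ γ)
      (fun k => Continuous.aestronglyMeasurable (by have := hcζ' k; fun_prop))
      (hE.const_mul _) (fun k => Eventually.of_forall fun x => ?_)
      (Eventually.of_forall fun x => tendsto_const_nhds.congr' ?_)
    · have hsplit : ‖gradient u x‖ * ‖gradient u x‖ ^ (γ - 1) = ‖gradient u x‖ ^ γ := by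
        rcases (hV0 x).eq_or_lt with h | h
        · rw [← h, zero_mul, Real.zero_rpow (by linarith)]
        · rw [mul_comm, ← Real.rpow_add_one h.ne', sub_add_cancel]
      calc ‖fderiv ℝ u x x * fderiv ℝ (ζ k) x (gammaFlux γ u x)‖
          ≤ (‖gradient u x‖ * ‖x‖) * (‖fderiv ℝ (ζ k) x‖ * ‖gradient u x‖ ^ (γ - 1)) := by
            rw [norm_mul]
            refine mul_le_mul ?_ (abs_apply_gammaFlux_le hγ _ x) (norm_nonneg _) (by positivity)
            rw [norm_gradient_eq]
            exact (fderiv ℝ u x).le_opNorm x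
        _ = ‖x‖ * ‖fderiv ℝ (ζ k) x‖ * (‖gradient u x‖ * ‖gradient u x‖ ^ (γ - 1)) := by ring
        _ ≤ 2 * C * ‖gradient u x‖ ^ γ := by
            rw [hsplit]
            exact mul_le_mul_of_nonneg_right (hζ2C k x) (by positivity)
    · filter_upwards [hζev' x] with k hk
      simp [hk]
  have hleft := (hζE.const_mul (γ - n)).sub hB2
  have hmid : Tendsto (fun k => ∫ x, ζ k x * u x ^ p * fderiv ℝ u x x) atTop
      (𝓝 ((p + 1)⁻¹ * (-(n * I) - 0))) := by
    refine (((hζU.const_mul (n : ℝ)).neg.sub hB3).const_mul (p + 1)⁻¹).congr fun k => ?_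
    rw [← hu.integral_mul_rpow_mul_fderiv (hζ k).contDiff (hζ k).hasCompactSupport,
      inv_mul_cancel_left₀ (by linarith)]
  have hright := (hmid.sub hB4).const_mul γ
  -- In the limit the Pohozaev identity reads (γ - n) I = -γ n I/(p+1).
  have heq := tendsto_nhds_unique (hleft.congr fun k =>
    hu.pohozaev hγ (hζ k).contDiff (hζ k).hasCompactSupport (hζ k).nonneg) hright
  have hnγ : (0 : ℝ) < n - γ := by linarith
  have hp1 : p + 1 ≠ 0 := by linarith
  field_simp at heq
  have hfac : I * ((p + 1) * (n - γ) - n * γ) = 0 := by linear_combination -heq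
  rw [eq_sub_iff_add_eq, eq_div_iff hnγ.ne']
  linarith [(mul_eq_zero.1 hfac).resolve_left hIpos.ne']

end Nonexistence

/-! ### The Aubin–Talenti solutions -/

section Existence

variable {n : ℕ} {γ : ℝ}

/-- The Aubin–Talenti profile raised to the power `s`, up to a factor. -/
theorem hasFDerivAt_const_mul_one_add_norm_rpow {q : ℝ} (hq : 1 < q) (c s : ℝ)
    (x : EuclideanSpace ℝ (Fin n)) :
    HasFDerivAt (fun x : EuclideanSpace ℝ (Fin n) => c * (1 + ‖x‖ ^ q) ^ s)
      ((c * s * q * (1 + ‖x‖ ^ q) ^ (s - 1) * ‖x‖ ^ (q - 2)) • innerSL ℝ x) x := by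
  have h1 : HasFDerivAt (fun x : EuclideanSpace ℝ (Fin n) => 1 + ‖x‖ ^ q) _ x :=
    (hasFDerivAt_norm_rpow x hq).const_add 1
  have hpos : 0 < 1 + ‖x‖ ^ q := by positivity
  have h2 := (h1.rpow_const (p := s) (Or.inl hpos.ne')).const_mul c
  convert! h2 using 1
  rw [smul_smul, smul_smul]
  congr 1
  ring

theorem contDiff_const_mul_one_add_norm_rpow {q : ℝ} (hq : 1 < q) (c s : ℝ) :
    ContDiff ℝ 1 (fun x : EuclideanSpace ℝ (Fin n) => c * (1 + ‖x‖ ^ q) ^ s) := by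
  refine contDiff_const.mul (ContDiff.rpow_const_of_ne ?_ fun x => ?_)
  · exact contDiff_const.add (contDiff_norm_rpow hq)
  · have : 0 < 1 + ‖x‖ ^ q := by positivity
    exact this.ne'

theorem gradient_const_mul_one_add_norm_rpow {q : ℝ} (hq : 1 < q) (c s : ℝ)
    (x : EuclideanSpace ℝ (Fin n)) :
    gradient (fun x : EuclideanSpace ℝ (Fin n) => c * (1 + ‖x‖ ^ q) ^ s) x
      = (c * s * q * (1 + ‖x‖ ^ q) ^ (s - 1) * ‖x‖ ^ (q - 2)) • x := by
  rw [gradient, (hasFDerivAt_const_mul_one_add_norm_rpow hq c s x).fderiv]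
  rw [map_smul]
  congr 1
  rw [LinearIsometryEquiv.symm_apply_eq]
  rfl

theorem norm_gradient_const_mul_one_add_norm_rpow {q : ℝ} (hq : 1 < q) {c s : ℝ} (hc : 0 < c)
    (hs : s < 0) (x : EuclideanSpace ℝ (Fin n)) :
    ‖gradient (fun x : EuclideanSpace ℝ (Fin n) => c * (1 + ‖x‖ ^ q) ^ s) x‖
      = c * (-s * q) * (1 + ‖x‖ ^ q) ^ (s - 1) * ‖x‖ ^ (q - 1) := by
  have hs' : 0 < -s := by linarith
  have hq' : 0 < q := by linarith
  have h1 : c * s * q * (1 + ‖x‖ ^ q) ^ (s - 1) * ‖x‖ ^ (q - 2)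
      = -(c * (-s * q) * (1 + ‖x‖ ^ q) ^ (s - 1) * ‖x‖ ^ (q - 2)) := by ring
  rw [gradient_const_mul_one_add_norm_rpow hq, h1, norm_smul, norm_neg,
    Real.norm_of_nonneg (by positivity), mul_assoc]
  congr 1
  rcases (norm_nonneg x).eq_or_lt with h | h
  · rw [← h, mul_zero, Real.zero_rpow (by linarith)]
  · rw [← Real.rpow_add_one h.ne']
    ring_nf

/-- This is div(f x) = n f + x·∇f. In the application s q = -n, and the last factor collapses to n.
-/
theorem euclideanDiv_radial {q : ℝ} (hq : 1 < q) (a s : ℝ) (x : EuclideanSpace ℝ (Fin n)) :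
    euclideanDiv (fun x : EuclideanSpace ℝ (Fin n) => (a * (1 + ‖x‖ ^ q) ^ s) • x) x
      = a * (1 + ‖x‖ ^ q) ^ (s - 1) * (n * (1 + ‖x‖ ^ q) + s * q * ‖x‖ ^ q) := by
  have hpos : 0 < 1 + ‖x‖ ^ q := by positivity
  have h := (hasFDerivAt_const_mul_one_add_norm_rpow hq a s x).smul (hasFDerivAt_id x)
  have h' : HasFDerivAt (fun x : EuclideanSpace ℝ (Fin n) => (a * (1 + ‖x‖ ^ q) ^ s) • x) _ x := h
  have hnorm : ‖x‖ ^ (q - 2) * ∑ i, x i * x i = ‖x‖ ^ q := by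
    have hsq : ∑ i, x i * x i = ‖x‖ ^ 2 := by
      rw [EuclideanSpace.real_norm_sq_eq]
      exact Finset.sum_congr rfl fun i _ => (sq _).symm
    rw [hsq]
    rcases (norm_nonneg x).eq_or_lt with h | h
    · rw [← h, Real.zero_rpow (x := q) (by linarith)]
      simp
    · rw [← Real.rpow_natCast, ← Real.rpow_add h]
      norm_num
  have hB : (1 + ‖x‖ ^ q) ^ s = (1 + ‖x‖ ^ q) ^ (s - 1) * (1 + ‖x‖ ^ q) := by
    rw [← Real.rpow_add_one hpos.ne', sub_add_cancel]
  have hterm : ∀ i, (fderiv ℝ (fun x : EuclideanSpace ℝ (Fin n) => (a * (1 + ‖x‖ ^ q) ^ s) • x) x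
      (EuclideanSpace.single i 1)) i = a * (1 + ‖x‖ ^ q) ^ s
        + a * s * q * (1 + ‖x‖ ^ q) ^ (s - 1) * ‖x‖ ^ (q - 2) * (x i * x i) := by
    intro i
    rw [h'.fderiv]
    simp [EuclideanSpace.inner_single_right]
    ring
  rw [euclideanDiv, Finset.sum_congr rfl fun i _ => hterm i, Finset.sum_add_distrib,
    Finset.sum_const, ← Finset.mul_sum, mul_assoc _ (‖x‖ ^ (q - 2)), hnorm, hB]
  simp
  ring

/-- The exponent q = γ/(γ-1) satisfies (q-1)(γ-1) = 1, so the powers of |x| cancel up to the vector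
x itself. The flux is thereby C¹ also at the origin. -/
theorem gammaFlux_const_mul_one_add_norm_rpow (hγ : 1 < γ) {c s : ℝ} (hc : 0 < c)
    (hs : s < 0) :
    gammaFlux γ (fun x : EuclideanSpace ℝ (Fin n) => c * (1 + ‖x‖ ^ (γ / (γ - 1))) ^ s)
      = fun x => (-(c * (-s * (γ / (γ - 1)))) ^ (γ - 1)
        * (1 + ‖x‖ ^ (γ / (γ - 1))) ^ ((s - 1) * (γ - 1))) • x := by
  have hγ1 : 0 < γ - 1 := by linarith
  have hs' : 0 < -s := by linarith
  have hq : 1 < γ / (γ - 1) := by rw [lt_div_iff₀ hγ1]; linarith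
  have hq' : (γ / (γ - 1) - 1) * (γ - 1) = 1 := by field_simp; ring
  funext x
  rw [gammaFlux, norm_gradient_const_mul_one_add_norm_rpow hq hc hs,
    gradient_const_mul_one_add_norm_rpow hq]
  set q := γ / (γ - 1)
  rcases eq_or_ne x 0 with rfl | hx
  · simp
  have hx' : 0 < ‖x‖ := norm_pos_iff.2 hx
  have hq0 : 0 < q := by linarith
  have hpos : 0 < 1 + ‖x‖ ^ q := by positivity
  have hb : 0 < c * (-s * q) := by positivity
  rw [smul_smul]
  congr 1
  rw [Real.mul_rpow (by positivity) (by positivity), Real.mul_rpow hb.le (by positivity),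
    ← Real.rpow_mul hpos.le, ← Real.rpow_mul hx'.le]
  have e1 : (c * (-s * q)) ^ (γ - 1) = (c * (-s * q)) ^ (γ - 2) * (c * (-s * q)) := by
    rw [← Real.rpow_add_one hb.ne']; ring_nf
  have e2 : (1 + ‖x‖ ^ q) ^ ((s - 1) * (γ - 1))
      = (1 + ‖x‖ ^ q) ^ ((s - 1) * (γ - 2)) * (1 + ‖x‖ ^ q) ^ (s - 1) := by
    rw [← Real.rpow_add hpos]; ring_nf
  have e3 : ‖x‖ ^ ((q - 1) * (γ - 2)) * ‖x‖ ^ (q - 2) = 1 := by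
    rw [← Real.rpow_add hx', show (q - 1) * (γ - 2) + (q - 2) = 0 by linarith, Real.rpow_zero]
  rw [e1, e2]
  linear_combination (-(c * (-s * q)) ^ (γ - 2) * (c * (-s * q)) *
    (1 + ‖x‖ ^ q) ^ ((s - 1) * (γ - 2)) * (1 + ‖x‖ ^ q) ^ (s - 1)) * e3

theorem integrable_one_add_norm_rpow_rpow {q r : ℝ} (hq : 0 < q) (hr : 0 ≤ r) (hqr : n < q * r) :
    Integrable fun x : EuclideanSpace ℝ (Fin n) => (1 + ‖x‖ ^ q) ^ (-r) := by
  have h := (integrable_one_add_norm (E := EuclideanSpace ℝ (Fin n)) (μ := volume)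
    (r := q * r) (by rwa [finrank_euclideanSpace_fin])).const_mul (2 ^ (q * r))
  refine h.mono' (Measurable.aestronglyMeasurable (by fun_prop)) (Eventually.of_forall fun x => ?_)
  have hx : 0 ≤ ‖x‖ := norm_nonneg x
  -- The mean (1 + |x|)/2 is at most max(1, |x|); this reduces the claim to the integrability of (1
  -- + |x|)^(-qr).
  have hle : ((1 + ‖x‖) / 2) ^ q ≤ 1 + ‖x‖ ^ q := by
    have hxq : 0 ≤ ‖x‖ ^ q := by positivity
    rcases le_total ‖x‖ 1 with h1 | h1
    · have := Real.rpow_le_one (by positivity : 0 ≤ (1 + ‖x‖) / 2) (by linarith) hq.le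
      linarith
    · have := Real.rpow_le_rpow (by positivity) (by linarith : (1 + ‖x‖) / 2 ≤ ‖x‖) hq.le
      linarith
  rw [Real.norm_of_nonneg (by positivity)]
  calc (1 + ‖x‖ ^ q) ^ (-r) ≤ (((1 + ‖x‖) / 2) ^ q) ^ (-r) :=
        Real.rpow_le_rpow_of_nonpos (by positivity) hle (by linarith)
    _ = 2 ^ (q * r) * (1 + ‖x‖) ^ (-(q * r)) := by
        rw [← Real.rpow_mul (by positivity), Real.div_rpow (by positivity) (by positivity),
          mul_neg, Real.rpow_neg zero_le_two, div_inv_eq_mul, mul_comm]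

/-- The Aubin–Talenti functions are finite energy solutions for the critical exponent. -/
theorem exists_isPositiveClassicalSolution (hγ : 1 < γ) (hγn : γ < n) :
    ∃ u : EuclideanSpace ℝ (Fin n) → ℝ,
      IsPositiveClassicalSolution γ (n * γ / (n - γ) - 1) u ∧
        Integrable (fun x => ‖gradient u x‖ ^ γ) volume := by
  have hγ0 : 0 < γ := by linarith
  have hγ1 : 0 < γ - 1 := by linarith
  have hnγ : 0 < n - γ := by linarith
  have hn : (0 : ℝ) < n := by linarith
  set q := γ / (γ - 1) with hqdef
  have hq : 1 < q := by rw [hqdef, lt_div_iff₀ hγ1]; linarith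
  have hq0 : 0 < q := by linarith
  set s := -((n - γ) / γ) with hsdef
  have hs : s < 0 := neg_lt_zero.2 (by positivity)
  have hs' : 0 < -s := by linarith
  set p := n * γ / (n - γ) - 1 with hpdef
  have hpγ : p - (γ - 1) = γ ^ 2 / (n - γ) := by rw [hpdef]; field_simp; ring
  have hpγ0 : 0 < p - (γ - 1) := by rw [hpγ]; positivity
  set b := -s * q with hb
  have hb0 : 0 < b := by positivity
  set M := n * b ^ (γ - 1) with hM
  have hM0 : 0 < M := by positivity
  -- Matching constants in the equation requires c^p = n (c b)^(γ-1), that is, c^(p-(γ-1)) = n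
  -- b^(γ-1).
  set c := M ^ (p - (γ - 1))⁻¹ with hcdef
  have hc : 0 < c := by positivity
  have hcp : c ^ p = n * (c * b) ^ (γ - 1) := by
    have : c ^ (p - (γ - 1)) = M := Real.rpow_inv_rpow hM0.le hpγ0.ne'
    rw [Real.mul_rpow hc.le hb0.le, show p = (p - (γ - 1)) + (γ - 1) by ring, Real.rpow_add hc,
      this]
    ring
  have hflux := gammaFlux_const_mul_one_add_norm_rpow (n := n) hγ hc hs
  rw [← hqdef] at hflux
  refine ⟨fun x => c * (1 + ‖x‖ ^ q) ^ s, ⟨fun x => by positivity,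
    contDiff_const_mul_one_add_norm_rpow hq c s, ?_, fun x => ?_⟩, ?_⟩
  · rw [hflux]
    exact (contDiff_const_mul_one_add_norm_rpow hq _ _).smul contDiff_id
  · have hpos : 0 < 1 + ‖x‖ ^ q := by positivity
    rw [gammaLaplacian, hflux, euclideanDiv_radial hq,
      Real.mul_rpow (x := c) (y := (1 + ‖x‖ ^ q) ^ s) hc.le (by positivity),
      ← Real.rpow_mul hpos.le, hcp]
    -- The first relation removes |x|^q from the divergence; the second matches the remaining power
    -- of 1 + |x|^q with that of u^p.
    have e1 : (s - 1) * (γ - 1) * q = -n := by rw [hsdef, hqdef]; field_simp; ring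
    have e2 : s * p = (s - 1) * (γ - 1) - 1 := by rw [hsdef, hpdef]; field_simp; ring
    rw [e1, e2]
    ring
  · have hint : Integrable fun x : EuclideanSpace ℝ (Fin n) =>
        (c * b) ^ γ * (1 + ‖x‖ ^ q) ^ (-((n : ℝ) - 1)) := by
      -- The integrability condition n < q (n - 1) is equivalent to γ < n.
      refine (integrable_one_add_norm_rpow_rpow hq0 (by linarith) ?_).const_mul _
      rw [hqdef, div_mul_eq_mul_div, lt_div_iff₀ hγ1]
      linarith
    refine hint.mono' ?_ (Eventually.of_forall fun x => ?_)
    · have := (contDiff_const_mul_one_add_norm_rpow (n := n) hq c s).continuous_gradient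
      exact (this.norm.rpow_const fun x => Or.inr hγ0.le).aestronglyMeasurable
    · have hpos : 0 < 1 + ‖x‖ ^ q := by positivity
      have hx : 0 ≤ ‖x‖ := norm_nonneg x
      rw [Real.norm_of_nonneg (by positivity), norm_gradient_const_mul_one_add_norm_rpow hq hc hs,
        Real.mul_rpow (by positivity) (by positivity), Real.mul_rpow (by positivity)
        (by positivity), ← Real.rpow_mul hpos.le, ← Real.rpow_mul hx, mul_assoc]
      have e1 : (s - 1) * γ = -n := by rw [hsdef]; field_simp; ring
      have e2 : (q - 1) * γ = q := by rw [hqdef]; field_simp; ring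
      rw [e1, e2]
      refine mul_le_mul_of_nonneg_left ?_ (by positivity)
      calc (1 + ‖x‖ ^ q) ^ (-(n : ℝ)) * ‖x‖ ^ q
          ≤ (1 + ‖x‖ ^ q) ^ (-(n : ℝ)) * (1 + ‖x‖ ^ q) := by gcongr; linarith
        _ = (1 + ‖x‖ ^ q) ^ (-((n : ℝ) - 1)) := by
          rw [← Real.rpow_add_one hpos.ne']; ring_nf

end Existence

theorem theorem1p4 (n : ℕ) (γ : ℝ) (hγ : 1 < γ) (hγn : γ < (n : ℝ)) (p : ℝ) :
    (∃ u : EuclideanSpace ℝ (Fin n) → ℝ,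
        IsPositiveClassicalSolution γ p u ∧
          Integrable (fun x => ‖gradient u x‖ ^ γ) volume) ↔
      p = (n : ℝ) * γ / ((n : ℝ) - γ) - 1 := by
  constructor
  · rintro ⟨u, hu, hE⟩
    exact hu.exponent_eq hγ hγn hE
  · rintro rfl
    exact exists_isPositiveClassicalSolution hγ hγn
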